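/- Let $n\ge 1$. For $C\subset\mathbb{R}^{n+1}$ a convex body (a compact convex set with non-empty interior), write $|E|$ for the $(n+1)$-dimensional Lebesgue measure of $E$, and for a measurable set $E\subset C$ let $$P_C(E)=\sup\Big\{\int_E \operatorname{div}\xi\,dx \;:\; \xi \text{ a smooth vector field with compact support in } \operatorname{int}(C),\ |\xi|\le 1\Big\}\in[0,\infty]$$ be its relative perimeter. The isoperimetric profile of $C$ is $$I_C(v)=\inf\{P_C(E): E\subset C \text{ measurable},\ |E|=v\},\qquad 0\le v\le |C|.$$ Theorem. For every $n\ge 1$ and every $\rho$ there is a constant $M>0$, depending only on $n$ and $\rho$, with the following property. Let $C\subset\mathbb{R}^{n+1}$ be a convex body, $x,y\in C$ and $0<r<R$ with $R/r=\rho$ such that $\overline{B}(y,r)\subset C\subset\overline{B}(x,R)$. Then $$I_C(v)\ \ge\ M\,\min\{v,\,|C|-v\}^{n/(n+1)}\qquad\text{for all } 0\le v\le |C|.$$ -/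

import Mathlib

open MeasureTheory
open scoped ENNReal ContDiff

noncomputable section

/-- The divergence of a vector field on `ℝᵐ`: the sum of the partial derivatives `∂ξᵢ/∂xᵢ`. -/
def divergence {m : ℕ} (ξ : EuclideanSpace ℝ (Fin m) → EuclideanSpace ℝ (Fin m))
    (x : EuclideanSpace ℝ (Fin m)) : ℝ :=
  ∑ i : Fin m, (fderiv ℝ ξ x (EuclideanSpace.single i 1)) i

/-- The smooth vector fields with compact support contained in `U` and pointwise Euclidean norm
at most one. -/
structure IsTestField {m : ℕ} (U : Set (EuclideanSpace ℝ (Fin m)))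
    (ξ : EuclideanSpace ℝ (Fin m) → EuclideanSpace ℝ (Fin m)) : Prop where
  smooth : ContDiff ℝ ∞ ξ
  compactSupport : HasCompactSupport ξ
  support_subset : tsupport ξ ⊆ U
  norm_le_one : ∀ x, ‖ξ x‖ ≤ 1

/-- The relative perimeter `P_C(E)` of `E` in the interior of `C`, a value in `[0, ∞]`: the
supremum of `∫_E div ξ` over the test fields of `interior C`. The zero field is a test field, so
the supremum is nonnegative and truncating each integral at `0` does not change it. -/
def relPerimeter {m : ℕ} (C E : Set (EuclideanSpace ℝ (Fin m))) : ℝ≥0∞ :=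
  ⨆ (ξ : EuclideanSpace ℝ (Fin m) → EuclideanSpace ℝ (Fin m)) (_ : IsTestField (interior C) ξ),
    ENNReal.ofReal (∫ x in E, divergence ξ x)

/-- The isoperimetric profile `I_C(v)`: the infimum of `P_C(E)` over the Lebesgue measurable sets
`E ⊆ C` of volume `v`. -/
def isoperimetricProfile {m : ℕ} (C : Set (EuclideanSpace ℝ (Fin m))) (v : ℝ) : ℝ≥0∞ :=
  ⨅ (E : Set (EuclideanSpace ℝ (Fin m))) (_ : E ⊆ C) (_ : NullMeasurableSet E volume)
    (_ : volume E = ENNReal.ofReal v), relPerimeter C E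

/-- A convex body: a compact convex set with nonempty interior. -/
structure IsConvexBody {m : ℕ} (C : Set (EuclideanSpace ℝ (Fin m))) : Prop where
  convex : Convex ℝ C
  isCompact : IsCompact C
  interior_nonempty : (interior C).Nonempty

end

open MeasureTheory
open scoped ENNReal ContDiff Convolution

variable {n : ℕ}

theorem enorm_sub_le_lintegral_fderiv_segment {V : Type*} [NormedAddCommGroup V] [NormedSpace ℝ V]
    {u : V → ℝ} (hu : ContDiff ℝ 1 u) (x y : V) :
    ‖u x - u y‖ₑ ≤ ∫⁻ t in Set.Ioc (0 : ℝ) 1, ‖fderiv ℝ u (x + t • (y - x))‖ₑ * ‖y - x‖ₑ := by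
  have hd : ∀ t : ℝ, HasDerivAt (fun t : ℝ => u (x + t • (y - x)))
      (fderiv ℝ u (x + t • (y - x)) (y - x)) t := by
    intro t
    have h1 : HasDerivAt (fun t : ℝ => x + t • (y - x)) (y - x) t := by
      simpa using ((hasDerivAt_id t).smul_const (y - x)).const_add x
    exact ((hu.differentiable one_ne_zero _).hasFDerivAt).comp_hasDerivAt t h1
  have hc : Continuous (fun t : ℝ => fderiv ℝ u (x + t • (y - x)) (y - x)) := by
    have := hu.continuous_fderiv one_ne_zero
    fun_prop
  have h := intervalIntegral.integral_eq_sub_of_hasDerivAt (fun t _ => hd t)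
    (hc.intervalIntegrable 0 1)
  have h2 : u x - u y = - ∫ t in (0 : ℝ)..1, fderiv ℝ u (x + t • (y - x)) (y - x) := by
    rw [h]; simp
  rw [h2, enorm_neg, intervalIntegral.integral_of_le zero_le_one]
  refine (enorm_integral_le_lintegral_enorm _).trans (lintegral_mono fun t => ?_)
  exact ContinuousLinearMap.le_opENorm _ _

theorem lintegral_comp_add_smul_eq {V : Type*} [NormedAddCommGroup V] [NormedSpace ℝ V]
    [FiniteDimensional ℝ V] [MeasurableSpace V] [BorelSpace V] (μ : Measure V) [μ.IsAddHaarMeasure]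
    {g : V → ℝ≥0∞} (hg : Measurable g) (x : V) {t : ℝ} (ht : 0 < t) :
    ∫⁻ w, g (x + t • w) ∂μ = ENNReal.ofReal ((t ^ Module.finrank ℝ V)⁻¹) * ∫⁻ z, g z ∂μ := by
  have h := Measure.map_addHaar_smul μ ht.ne'
  have h1 : ∫⁻ w, g (x + t • w) ∂μ = ∫⁻ z, g (x + z) ∂(μ.map (t • ·)) := by
    rw [lintegral_map (by fun_prop) (by fun_prop)]
  rw [h1, h, lintegral_smul_measure, lintegral_add_left_eq_self, abs_of_pos (by positivity)]
  rfl

theorem lintegral_segment_le_of_ball {V : Type*} [NormedAddCommGroup V] [NormedSpace ℝ V]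
    [FiniteDimensional ℝ V] [MeasurableSpace V] [BorelSpace V] (μ : Measure V) [μ.IsAddHaarMeasure]
    {g : V → ℝ≥0∞} (hg : Measurable g) (A B : Set V) (t : ℝ) :
    ∫⁻ x in A, ∫⁻ w in B, g (x + t • w) ∂μ ∂μ ≤ μ B * ∫⁻ z, g z ∂μ := by
  rw [lintegral_lintegral_swap (by fun_prop)]
  calc ∫⁻ w in B, ∫⁻ x in A, g (x + t • w) ∂μ ∂μ ≤ ∫⁻ w in B, ∫⁻ z, g z ∂μ ∂μ := by
        refine lintegral_mono fun w => (setLIntegral_le_lintegral _ _).trans ?_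
        rw [lintegral_add_right_eq_self]
    _ = _ := by rw [setLIntegral_const, mul_comm]

theorem lintegral_segment_le_of_pos {V : Type*} [NormedAddCommGroup V] [NormedSpace ℝ V]
    [FiniteDimensional ℝ V] [MeasurableSpace V] [BorelSpace V] (μ : Measure V) [μ.IsAddHaarMeasure]
    {g : V → ℝ≥0∞} (hg : Measurable g) (A B : Set V) {t : ℝ} (ht : 0 < t) :
    ∫⁻ x in A, ∫⁻ w in B, g (x + t • w) ∂μ ∂μ ≤
      μ A * (ENNReal.ofReal ((t ^ Module.finrank ℝ V)⁻¹) * ∫⁻ z, g z ∂μ) := by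
  calc _ ≤ ∫⁻ x in A, ENNReal.ofReal ((t ^ Module.finrank ℝ V)⁻¹) * ∫⁻ z, g z ∂μ ∂μ := by
        refine lintegral_mono fun x => (setLIntegral_le_lintegral _ _).trans ?_
        rw [lintegral_comp_add_smul_eq μ hg x ht]
    _ = _ := by rw [setLIntegral_const, mul_comm]

theorem lintegral_Ioi_inv_pow (hn : 1 ≤ n) {a : ℝ} (ha : 0 < a) :
    ∫⁻ t in Set.Ioi a, ENNReal.ofReal ((t ^ (n + 1))⁻¹) = ENNReal.ofReal ((a ^ n)⁻¹ / n) := by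
  have hn' : (1 : ℝ) ≤ n := by exact_mod_cast hn
  have key : ∀ t ∈ Set.Ioi a, (t ^ (n + 1))⁻¹ = t ^ (-((n : ℝ) + 1)) := by
    intro t ht
    rw [Real.rpow_neg (ha.trans ht).le]; norm_cast
  have hlt : -((n : ℝ) + 1) < -1 := by linarith
  rw [setLIntegral_congr_fun measurableSet_Ioi
      (fun t ht => congrArg ENNReal.ofReal (key t ht)),
    ← ofReal_integral_eq_lintegral_ofReal
      (integrableOn_Ioi_rpow_of_lt hlt ha), integral_Ioi_rpow_of_lt hlt ha]
  · congr 1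
    have : -((n : ℝ) + 1) + 1 = -n := by ring
    rw [this, Real.rpow_neg ha.le, Real.rpow_natCast]
    rw [neg_div_neg_eq]
  · filter_upwards [ae_restrict_mem measurableSet_Ioi] with t ht
    exact Real.rpow_nonneg (ha.trans ht).le _

theorem lintegral_Ioc_segment_le {V : Type*} [NormedAddCommGroup V] [NormedSpace ℝ V]
    [FiniteDimensional ℝ V] [MeasurableSpace V] [BorelSpace V] (μ : Measure V) [μ.IsAddHaarMeasure]
    (hV : Module.finrank ℝ V = n + 1) (hn : 1 ≤ n) {g : V → ℝ≥0∞} (hg : Measurable g)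
    {A : Set V} {b D : ℝ} (hb : 0 < b) (hD : 0 < D) (hA : μ A = ENNReal.ofReal (b ^ (n + 1))) :
    ∫⁻ t in Set.Ioc (0 : ℝ) 1, ∫⁻ x in A, ∫⁻ w in Metric.closedBall (0 : V) D,
        g (x + t • w) ∂μ ∂μ ≤
      ENNReal.ofReal (((μ (Metric.ball 0 1)).toReal + 1 / n) * D ^ n * b) * ∫⁻ z, g z ∂μ := by
  set G := ∫⁻ z, g z ∂μ
  set κ := (μ (Metric.ball (0 : V) 1)).toReal with hκ
  have hκ0 : 0 ≤ κ := ENNReal.toReal_nonneg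
  have hball : μ (Metric.closedBall (0 : V) D) = ENNReal.ofReal (D ^ (n + 1) * κ) := by
    rw [Measure.addHaar_closedBall μ _ hD.le, hV, ENNReal.ofReal_mul (by positivity), hκ,
      ENNReal.ofReal_toReal measure_ball_lt_top.ne]
  have ht0 : 0 < b / D := by positivity
  have h1 : ∫⁻ t in Set.Ioc (0 : ℝ) (b / D), ∫⁻ x in A, ∫⁻ w in Metric.closedBall (0 : V) D,
      g (x + t • w) ∂μ ∂μ ≤ ENNReal.ofReal (κ * D ^ n * b) * G := by
    calc _ ≤ ∫⁻ t in Set.Ioc (0 : ℝ) (b / D), μ (Metric.closedBall (0 : V) D) * G :=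
          lintegral_mono fun t => lintegral_segment_le_of_ball μ hg _ _ t
      _ = _ := by
        rw [setLIntegral_const, Real.volume_Ioc, sub_zero, hball, mul_right_comm,
          ← ENNReal.ofReal_mul (by positivity)]
        congr 2
        field_simp
        ring
  have h2 : ∫⁻ t in Set.Ioi (b / D), ∫⁻ x in A, ∫⁻ w in Metric.closedBall (0 : V) D,
      g (x + t • w) ∂μ ∂μ ≤ ENNReal.ofReal (1 / n * D ^ n * b) * G := by
    calc _ ≤ ∫⁻ t in Set.Ioi (b / D), μ A * (ENNReal.ofReal ((t ^ (n + 1))⁻¹) * G) :=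
          setLIntegral_mono' measurableSet_Ioi fun t ht => by
            simpa [hV] using lintegral_segment_le_of_pos μ hg A (Metric.closedBall 0 D)
              (ht0.trans ht)
      _ = _ := by
        rw [lintegral_const_mul _ (by fun_prop), lintegral_mul_const _ (by fun_prop),
          lintegral_Ioi_inv_pow hn ht0, hA, ← mul_assoc, ← ENNReal.ofReal_mul (by positivity)]
        congr 2
        rw [div_pow, pow_succ]
        field_simp
  calc _ ≤ ∫⁻ t in Set.Ioc (0 : ℝ) (b / D) ∪ Set.Ioi (b / D), ∫⁻ x in A,
          ∫⁻ w in Metric.closedBall (0 : V) D, g (x + t • w) ∂μ ∂μ :=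
        lintegral_mono_set fun t ht => by
          rcases le_or_gt t (b / D) with h | h
          · exact Or.inl ⟨ht.1, h⟩
          · exact Or.inr h
    _ ≤ _ := (lintegral_union_le _ _ _).trans (add_le_add h1 h2)
    _ = _ := by
        rw [← add_mul, ← ENNReal.ofReal_add (by positivity) (by positivity)]
        congr 2
        ring

/-- The weak form of the `L¹` Poincaré inequality on a convex set `K` of diameter at most `D`: the
left-hand side is estimated by the gradient and the measure of `A` alone. -/
theorem lintegral_lintegral_enorm_sub_le {V : Type*} [NormedAddCommGroup V] [NormedSpace ℝ V]
    [FiniteDimensional ℝ V] [MeasurableSpace V] [BorelSpace V] (μ : Measure V) [μ.IsAddHaarMeasure]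
    (hV : Module.finrank ℝ V = n + 1) (hn : 1 ≤ n) {u : V → ℝ} (hu : ContDiff ℝ 1 u)
    {K A B : Set V} (hK : Convex ℝ K) (hKm : MeasurableSet K) (hAK : A ⊆ K) (hBK : B ⊆ K)
    (hAm : NullMeasurableSet A μ) (hBm : NullMeasurableSet B μ)
    {b D : ℝ} (hb : 0 < b) (hD : 0 < D) (hA : μ A = ENNReal.ofReal (b ^ (n + 1)))
    (hdiam : ∀ x ∈ K, ∀ y ∈ K, ‖y - x‖ ≤ D) :
    ∫⁻ x in A, ∫⁻ y in B, ‖u x - u y‖ₑ ∂μ ∂μ ≤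
      ENNReal.ofReal (((μ (Metric.ball 0 1)).toReal + 1 / n) * D ^ (n + 1) * b) *
        ∫⁻ z in K, ‖fderiv ℝ u z‖ₑ ∂μ := by
  set g : V → ℝ≥0∞ := K.indicator fun z => ‖fderiv ℝ u z‖ₑ with hgdef
  have hcont := hu.continuous_fderiv one_ne_zero
  have hg : Measurable g := (Continuous.measurable (by fun_prop)).indicator hKm
  have hG : ∫⁻ z in K, ‖fderiv ℝ u z‖ₑ ∂μ = ∫⁻ z, g z ∂μ := (lintegral_indicator hKm _).symm
  have hpt : ∀ x ∈ K, ∀ y ∈ K, ‖u x - u y‖ₑ ≤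
      ENNReal.ofReal D * ∫⁻ t in Set.Ioc (0 : ℝ) 1, g (x + t • (y - x)) := by
    intro x hx y hy
    refine (enorm_sub_le_lintegral_fderiv_segment hu x y).trans ?_
    rw [← lintegral_const_mul _ (by fun_prop)]
    refine setLIntegral_mono' measurableSet_Ioc fun t ht => ?_
    have hz : x + t • (y - x) ∈ K := hK.add_smul_sub_mem hx hy ⟨ht.1.le, ht.2⟩
    rw [hgdef, Set.indicator_of_mem hz, mul_comm]
    gcongr
    rw [← ofReal_norm]
    exact ENNReal.ofReal_le_ofReal (hdiam x hx y hy)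
  have hinner : ∀ x ∈ K, ∫⁻ y in B, ‖u x - u y‖ₑ ∂μ ≤
      ENNReal.ofReal D * ∫⁻ w in Metric.closedBall (0 : V) D,
        (∫⁻ t in Set.Ioc (0 : ℝ) 1, g (x + t • w)) ∂μ := by
    intro x hx
    have hm : Measurable fun w : V => ∫⁻ t in Set.Ioc (0 : ℝ) 1, g (x + t • w) :=
      Measurable.lintegral_prod_right (f := fun w => fun t : ℝ => g (x + t • w)) (by fun_prop)
    calc _ ≤ ∫⁻ y in B, ENNReal.ofReal D *
            (∫⁻ t in Set.Ioc (0 : ℝ) 1, g (x + t • (y - x))) ∂μ := by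
          refine lintegral_mono_ae ?_
          filter_upwards [ae_restrict_mem₀ hBm] with y hy using hpt x hx y (hBK hy)
      _ ≤ ∫⁻ y in Metric.closedBall x D, ENNReal.ofReal D *
            (∫⁻ t in Set.Ioc (0 : ℝ) 1, g (x + t • (y - x))) ∂μ :=
          lintegral_mono_set fun y hy => by
            simpa [dist_eq_norm] using hdiam x hx y (hBK hy)
      _ = _ := by
          rw [← lintegral_const_mul _ hm, ← lintegral_indicator measurableSet_closedBall,
            ← lintegral_indicator measurableSet_closedBall]
          refine Eq.trans ?_ (lintegral_sub_right_eq_self (μ := μ) _ x)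
          congr 1 with y
          simp [Set.indicator, dist_eq_norm]
  calc _ ≤ ∫⁻ x in A, ENNReal.ofReal D * ∫⁻ w in Metric.closedBall (0 : V) D,
        (∫⁻ t in Set.Ioc (0 : ℝ) 1, g (x + t • w)) ∂μ ∂μ := by
          refine lintegral_mono_ae ?_
          filter_upwards [ae_restrict_mem₀ hAm] with x hx using hinner x (hAK hx)
    _ = ENNReal.ofReal D * ∫⁻ x in A, ∫⁻ w in Metric.closedBall (0 : V) D,
        (∫⁻ t in Set.Ioc (0 : ℝ) 1, g (x + t • w)) ∂μ ∂μ :=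
          lintegral_const_mul' _ _ ENNReal.ofReal_ne_top
    _ = ENNReal.ofReal D * ∫⁻ x in A, (∫⁻ t in Set.Ioc (0 : ℝ) 1,
        ∫⁻ w in Metric.closedBall (0 : V) D, g (x + t • w) ∂μ) ∂μ := by
          congr 2 with x
          rw [lintegral_lintegral_swap (by fun_prop)]
    _ = ENNReal.ofReal D * ∫⁻ t in Set.Ioc (0 : ℝ) 1, ∫⁻ x in A,
        ∫⁻ w in Metric.closedBall (0 : V) D, g (x + t • w) ∂μ ∂μ := by
          rw [lintegral_lintegral_swap]
          refine Measurable.aemeasurable ?_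
          refine Measurable.lintegral_prod_right
            (f := fun p : V × ℝ => fun w : V => g (p.1 + p.2 • w)) ?_
          fun_prop
    _ ≤ ENNReal.ofReal D * (ENNReal.ofReal (((μ (Metric.ball 0 1)).toReal + 1 / n) * D ^ n * b) *
          ∫⁻ z, g z ∂μ) := by
          gcongr
          exact lintegral_Ioc_segment_le μ hV hn hg hb hD hA
    _ = _ := by
          rw [hG, ← mul_assoc, ← ENNReal.ofReal_mul hD.le]
          congr 2
          ring

section Mollify

variable {V : Type*} [NormedAddCommGroup V] [NormedSpace ℝ V]
    [MeasurableSpace V] [BorelSpace V] {μ : Measure V}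
    {F : Type*} [NormedAddCommGroup F] [NormedSpace ℝ F]

theorem contDiff_integral_comp_sub_smul {φ : V → ℝ} (hφ : ContDiff ℝ ∞ φ)
    (hφc : HasCompactSupport φ) {f : V → F} (hf : LocallyIntegrable f μ) :
    ContDiff ℝ ∞ fun x => ∫ t, φ (x - t) • f t ∂μ := by
  exact hφc.contDiff_convolution_right (ContinuousLinearMap.lsmul ℝ ℝ).flip hf hφ

theorem fderiv_integral_comp_sub_smul [FiniteDimensional ℝ V]
    [μ.IsAddHaarMeasure] {φ : V → ℝ} (hφ : ContDiff ℝ ∞ φ)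
    (hφc : HasCompactSupport φ) {f : V → F} (hf : LocallyIntegrable f μ) (x v : V) :
    fderiv ℝ (fun x => ∫ t, φ (x - t) • f t ∂μ) x v = ∫ t, fderiv ℝ φ (x - t) v • f t ∂μ := by
  have hφ1 : ContDiff ℝ 1 φ := hφ.of_le (by exact_mod_cast le_top)
  have h := hφc.hasFDerivAt_convolution_right (ContinuousLinearMap.lsmul ℝ ℝ).flip hf hφ1 x
  have h2 : (fun x => ∫ t, φ (x - t) • f t ∂μ) =
    f ⋆[(ContinuousLinearMap.lsmul ℝ ℝ).flip, μ] φ := rfl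
  rw [h2, h.fderiv, convolution_precompR_apply _ hf (hφc.fderiv ℝ)
    (hφ1.continuous_fderiv one_ne_zero)]
  rfl

theorem integrable_fderiv_comp_sub_smul {φ : V → ℝ} (hφ : ContDiff ℝ ∞ φ)
    (hφc : HasCompactSupport φ) {f : V → F} (hf : LocallyIntegrable f μ) (x v : V) :
    Integrable (fun t => fderiv ℝ φ (x - t) v • f t) μ := by
  have hφ1 : ContDiff ℝ 1 φ := hφ.of_le (by exact_mod_cast le_top)
  have hc : Continuous fun z => fderiv ℝ φ z v := by
    have := hφ1.continuous_fderiv one_ne_zero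
    fun_prop
  exact (hφc.fderiv_apply ℝ v).convolutionExists_right (ContinuousLinearMap.lsmul ℝ ℝ).flip hf hc x

end Mollify

theorem divergence_integral_comp_sub_smul {m : ℕ} {φ : EuclideanSpace ℝ (Fin m) → ℝ}
    (hφ : ContDiff ℝ ∞ φ) (hφc : HasCompactSupport φ)
    {ξ : EuclideanSpace ℝ (Fin m) → EuclideanSpace ℝ (Fin m)} (hξ : LocallyIntegrable ξ)
    (x : EuclideanSpace ℝ (Fin m)) :
    divergence (fun x => ∫ t, φ (x - t) • ξ t) x = ∫ t, fderiv ℝ φ (x - t) (ξ t) := by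
  have hint := fun v => integrable_fderiv_comp_sub_smul hφ hφc hξ x v
  have hcoord : ∀ i, (∫ t, fderiv ℝ φ (x - t) (EuclideanSpace.single i 1) • ξ t) i =
      ∫ t, fderiv ℝ φ (x - t) (EuclideanSpace.single i 1) * ξ t i := fun i =>
    ((EuclideanSpace.proj (𝕜 := ℝ) i).integral_comp_comm (hint _)).symm
  simp only [divergence, fderiv_integral_comp_sub_smul hφ hφc hξ, hcoord]
  rw [← integral_finsetSum]
  · congr 1 with t
    conv_rhs => rw [← (EuclideanSpace.basisFun (Fin m) ℝ).sum_repr (ξ t)]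
    simp [mul_comm]
  · intro i _
    exact (EuclideanSpace.proj (𝕜 := ℝ) i).integrable_comp (hint (EuclideanSpace.single i 1))

theorem isTestField_integral_comp_sub_smul {m : ℕ} {C K : Set (EuclideanSpace ℝ (Fin m))} {ε : ℝ}
    (hK : IsCompact K) (hKC : Metric.cthickening ε K ⊆ interior C)
    {φ : EuclideanSpace ℝ (Fin m) → ℝ} (hφ : ContDiff ℝ ∞ φ)
    (hφ0 : ∀ x, 0 ≤ φ x) (hφ1 : ∫ x, φ x = 1) (hφs : tsupport φ ⊆ Metric.closedBall 0 ε)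
    {ξ : EuclideanSpace ℝ (Fin m) → EuclideanSpace ℝ (Fin m)} (hξ : LocallyIntegrable ξ)
    (hξ1 : ∀ x, ‖ξ x‖ ≤ 1) (hξK : ∀ x ∉ K, ξ x = 0) :
    IsTestField (interior C) fun x => ∫ t, φ (x - t) • ξ t := by
  have hφc : HasCompactSupport φ :=
    (isCompact_closedBall (0 : EuclideanSpace ℝ (Fin m)) ε).of_isClosed_subset
      (isClosed_tsupport φ) hφs
  have hts : tsupport (fun x => ∫ t, φ (x - t) • ξ t) ⊆ Metric.cthickening ε K := by
    refine closure_minimal (fun x hx => ?_) Metric.isClosed_cthickening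
    by_contra hxK
    refine hx ?_
    refine integral_eq_zero_of_ae (Filter.Eventually.of_forall fun t => ?_)
    by_cases ht : t ∈ K
    · have : φ (x - t) = 0 := by
        by_contra h
        have h2 := hφs (subset_tsupport φ h)
        rw [mem_closedBall_zero_iff, ← dist_eq_norm] at h2
        exact hxK (Metric.mem_cthickening_of_dist_le x t ε K ht h2)
      simp [this]
    · simp [hξK t ht]
  refine ⟨contDiff_integral_comp_sub_smul hφ hφc hξ,
    hK.cthickening.of_isClosed_subset (isClosed_tsupport _) hts, hts.trans hKC, fun x => ?_⟩
  calc ‖∫ t, φ (x - t) • ξ t‖ ≤ ∫ t, φ (x - t) := by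
        refine norm_integral_le_of_norm_le ?_ (Filter.Eventually.of_forall fun t => ?_)
        · exact (hφ.continuous.integrable_of_hasCompactSupport hφc).comp_sub_left x
        · rw [norm_smul, Real.norm_of_nonneg (hφ0 _)]
          exact mul_le_of_le_one_right (hφ0 _) (hξ1 t)
    _ = 1 := by rw [integral_sub_left_eq_self, hφ1]

/-- A mollification of the indicator of `E` has, on sets `K` well inside `C`, total variation at
most the relative perimeter of `E`. -/
theorem lintegral_enorm_fderiv_mollify_le {m : ℕ} {C K E : Set (EuclideanSpace ℝ (Fin m))} {ε : ℝ}
    (hK : IsCompact K) (hKC : Metric.cthickening ε K ⊆ interior C)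
    (hE : NullMeasurableSet E volume) (hEfin : volume E ≠ ⊤)
    {φ : EuclideanSpace ℝ (Fin m) → ℝ} (hφ : ContDiff ℝ ∞ φ)
    (hφ0 : ∀ x, 0 ≤ φ x) (hφ1 : ∫ x, φ x = 1) (hφs : tsupport φ ⊆ Metric.closedBall 0 ε)
    (hφn : ∀ x, φ (-x) = φ x) :
    ∫⁻ x in K, ‖fderiv ℝ (fun x => ∫ t, φ (x - t) • E.indicator (fun _ => (1 : ℝ)) t) x‖ₑ ≤
      relPerimeter C E := by
  classical
  have hφc : HasCompactSupport φ :=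
    (isCompact_closedBall (0 : EuclideanSpace ℝ (Fin m)) ε).of_isClosed_subset
      (isClosed_tsupport φ) hφs
  have hφC1 : ContDiff ℝ 1 φ := hφ.of_le (by exact_mod_cast le_top)
  have hdφ := hφC1.continuous_fderiv one_ne_zero
  set f : EuclideanSpace ℝ (Fin m) → ℝ := E.indicator (fun _ => (1 : ℝ)) with hf
  have hfint : Integrable f := (integrableOn_const hEfin).integrable_indicator₀ hE
  set u : EuclideanSpace ℝ (Fin m) → ℝ := fun x => ∫ t, φ (x - t) • f t with hu
  have huC : ContDiff ℝ ∞ u := contDiff_integral_comp_sub_smul hφ hφc hfint.locallyIntegrable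
  have hdu : Continuous (fderiv ℝ u) :=
    (huC.of_le (m := 1) (by exact_mod_cast le_top)).continuous_fderiv one_ne_zero
  set G : EuclideanSpace ℝ (Fin m) → EuclideanSpace ℝ (Fin m) := gradient u with hG
  have hGc : Continuous G :=
    (InnerProductSpace.toDual ℝ (EuclideanSpace ℝ (Fin m))).symm.continuous.comp hdu
  have hGn : ∀ x, ‖G x‖ = ‖fderiv ℝ u x‖ := fun x => by simp [hG, gradient]
  have hGi : ∀ x v, fderiv ℝ u x v = inner ℝ (G x) v := fun x v => by
    simp [hG, gradient]
  set ξ : EuclideanSpace ℝ (Fin m) → EuclideanSpace ℝ (Fin m) :=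
    K.indicator fun x => -(‖G x‖⁻¹ • G x) with hξdef
  have hKm := hK.measurableSet
  have hξm : Measurable ξ := by
    refine Measurable.indicator ?_ hKm
    have := hGc.measurable
    fun_prop
  have hξ1 : ∀ x, ‖ξ x‖ ≤ 1 := by
    intro x
    by_cases hx : x ∈ K
    · rw [hξdef, Set.indicator_of_mem hx, norm_neg, norm_smul, norm_inv, norm_norm]
      exact inv_mul_le_one
    · simp [hξdef, hx]
  have hξK : ∀ x ∉ K, ξ x = 0 := fun x hx => by simp [hξdef, hx]
  have hξi : Integrable ξ := by
    have : IntegrableOn ξ K := Measure.integrableOn_of_bounded hK.measure_lt_top.ne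
      hξm.aestronglyMeasurable (M := 1) (Filter.Eventually.of_forall hξ1)
    exact (integrableOn_iff_integrable_of_support_subset
      fun x hx => by_contra fun h => hx (hξK x h)).1 this
  have hη := isTestField_integral_comp_sub_smul hK hKC hφ hφ0 hφ1 hφs hξi.locallyIntegrable hξ1 hξK
  have hdodd : ∀ x v, fderiv ℝ φ (-x) v = - fderiv ℝ φ x v := by
    intro x v
    have h1 := ((hφC1.differentiable one_ne_zero (-x)).hasFDerivAt.comp x
      (hasFDerivAt_id x).neg).fderiv
    have h2 : φ ∘ Neg.neg = φ := funext hφn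
    rw [h2] at h1
    simp [h1]
  have hkey : ∫ x in E, divergence (fun x => ∫ t, φ (x - t) • ξ t) x =
      ∫ x in K, ‖fderiv ℝ u x‖ := by
    have hFub : Integrable (Function.uncurry fun x t => f x * fderiv ℝ φ (x - t) (ξ t))
        (volume.prod volume) := by
      obtain ⟨c, hc⟩ := (hφc.fderiv ℝ).exists_bound_of_continuous hdφ
      refine Integrable.mono' ((hfint.norm.mul_prod hξi.norm).const_mul c) ?_ ?_
      · refine AEStronglyMeasurable.mul hfint.aestronglyMeasurable.comp_fst ?_
        refine Measurable.aestronglyMeasurable ?_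
        have h1 : Measurable fun p : EuclideanSpace ℝ (Fin m) × EuclideanSpace ℝ (Fin m) =>
          fderiv ℝ φ (p.1 - p.2) := by
            have := hdφ.measurable
            fun_prop
        have hap : Continuous fun q : (EuclideanSpace ℝ (Fin m) →L[ℝ] ℝ) ×
            EuclideanSpace ℝ (Fin m) => q.1 q.2 := by fun_prop
        exact hap.measurable.comp (h1.prodMk (hξm.comp measurable_snd))
      · refine Filter.Eventually.of_forall fun p => ?_
        simp only [Function.uncurry, norm_mul]
        calc _ ≤ ‖f p.1‖ * (c * ‖ξ p.2‖) := by
              gcongr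
              exact (ContinuousLinearMap.le_opNorm _ _).trans (by gcongr; exact hc _)
          _ = _ := by ring
    calc _ = ∫ x, f x * ∫ t, fderiv ℝ φ (x - t) (ξ t) := by
          rw [← integral_indicator₀ hE]
          congr 1 with x
          rw [hf]
          by_cases hx : x ∈ E <;>
            simp [hx, divergence_integral_comp_sub_smul hφ hφc hξi.locallyIntegrable]
      _ = ∫ x, ∫ t, f x * fderiv ℝ φ (x - t) (ξ t) := by simp only [integral_const_mul]
      _ = ∫ t, ∫ x, f x * fderiv ℝ φ (x - t) (ξ t) := integral_integral_swap hFub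
      _ = ∫ t, - fderiv ℝ u t (ξ t) := by
          congr 1 with t
          rw [hu, fderiv_integral_comp_sub_smul hφ hφc hfint.locallyIntegrable, ← integral_neg]
          congr 1 with x
          rw [← neg_sub t x, hdodd]
          simp [mul_comm]
      _ = ∫ t, K.indicator (fun x => ‖fderiv ℝ u x‖) t := by
          congr 1 with t
          by_cases ht : t ∈ K
          · rw [hξdef, Set.indicator_of_mem ht, Set.indicator_of_mem ht, hGi, inner_neg_right,
              neg_neg, real_inner_smul_right, real_inner_self_eq_norm_mul_norm, ← hGn]
            by_cases h0 : ‖G t‖ = 0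
            · simp [h0]
            · field_simp
          · simp [hξdef, ht]
      _ = _ := integral_indicator hKm
  have hint : IntegrableOn (fun x => ‖fderiv ℝ u x‖) K := hdu.norm.continuousOn.integrableOn_compact hK
  calc _ = ENNReal.ofReal (∫ x in K, ‖fderiv ℝ u x‖) := by
        rw [ofReal_integral_eq_lintegral_ofReal hint
          (Filter.Eventually.of_forall fun _ => norm_nonneg _)]
        simp only [ofReal_norm]
    _ ≤ _ := by
        rw [← hkey]
        exact le_iSup₂ (f := fun ξ (_ : IsTestField (interior C) ξ) =>
          ENNReal.ofReal (∫ x in E, divergence ξ x)) _ hη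

open Filter Topology in
theorem volume_mul_volume_le_of_cthickening_subset (hn : 1 ≤ n)
    {C K E A B : Set (EuclideanSpace ℝ (Fin (n + 1)))} {ε D : ℝ} (hε : 0 < ε) (hD : 0 < D)
    (hK : IsCompact K) (hKconv : Convex ℝ K) (hKC : Metric.cthickening ε K ⊆ interior C)
    (hdiam : ∀ x ∈ K, ∀ y ∈ K, ‖y - x‖ ≤ D)
    (hE : NullMeasurableSet E volume) (hEfin : volume E ≠ ⊤)
    (hAK : A ⊆ K) (hBK : B ⊆ K) (hAm : NullMeasurableSet A volume)
    (hBm : NullMeasurableSet B volume)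
    (hAB : ∀ x ∈ A, ∀ y ∈ B, ‖E.indicator (fun _ => (1 : ℝ)) x - E.indicator (fun _ => (1 : ℝ)) y‖ₑ = 1) :
    volume A * volume B ≤
      ENNReal.ofReal (((volume (Metric.ball (0 : EuclideanSpace ℝ (Fin (n + 1))) 1)).toReal
        + 1 / n) * D ^ (n + 1)) * volume A ^ (1 / ((n : ℝ) + 1)) * relPerimeter C E := by
  rcases eq_or_ne (volume A) 0 with hA0 | hA0
  · simp [hA0]
  have hAfin : volume A ≠ ⊤ := ((measure_mono hAK).trans_lt hK.measure_lt_top).ne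
  set f : EuclideanSpace ℝ (Fin (n + 1)) → ℝ := E.indicator (fun _ => (1 : ℝ)) with hf
  have hfint : Integrable f := (integrableOn_const hEfin).integrable_indicator₀ hE
  set a := (volume A).toReal with ha
  have ha0 : 0 < a := ENNReal.toReal_pos hA0 hAfin
  have hAa : volume A = ENNReal.ofReal a := (ENNReal.ofReal_toReal hAfin).symm
  set b := a ^ (1 / ((n : ℝ) + 1)) with hb
  have hb0 : 0 < b := Real.rpow_pos_of_pos ha0 _
  have hAb : volume A = ENNReal.ofReal (b ^ (n + 1)) := by
    rw [hAa, hb, ← Real.rpow_natCast, ← Real.rpow_mul ha0.le]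
    congr 1
    push_cast
    rw [one_div_mul_cancel (by positivity), Real.rpow_one]
  have hpos : ∀ k : ℕ, 0 < ε / (k + 1) := fun k => by positivity
  let φ : ℕ → ContDiffBump (0 : EuclideanSpace ℝ (Fin (n + 1))) := fun k =>
    ⟨ε / (k + 1) / 2, ε / (k + 1), half_pos (hpos k), half_lt_self (hpos k)⟩
  let u : ℕ → EuclideanSpace ℝ (Fin (n + 1)) → ℝ := fun k x =>
    ∫ t, (φ k).normed volume (x - t) • f t
  have huC : ∀ k, ContDiff ℝ ∞ (u k) := fun k => contDiff_integral_comp_sub_smul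
    (φ k).contDiff_normed (φ k).hasCompactSupport_normed hfint.locallyIntegrable
  have hconv : ∀ᵐ x, Tendsto (fun k => u k x) atTop (𝓝 (f x)) := by
    have h0 : Tendsto (fun k => (φ k).rOut) atTop (𝓝 0) :=
      tendsto_const_div_atTop_nhds_zero_nat ε |>.comp (tendsto_add_atTop_nat 1) |>.congr
        fun k => by simp [φ]
    have h1 : ∀ᶠ k in atTop, (φ k).rOut ≤ 2 * (φ k).rIn := Eventually.of_forall fun k => by
      simp only [φ]; linarith
    filter_upwards [ContDiffBump.ae_convolution_tendsto_right_of_locallyIntegrable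
      (μ := volume) h0 h1 hfint.locallyIntegrable] with x hx
    refine hx.congr fun k => ?_
    rw [convolution_lsmul_swap]
  have hbound : ∀ k, ∫⁻ x in A, ∫⁻ y in B, ‖u k x - u k y‖ₑ ≤
      ENNReal.ofReal (((volume (Metric.ball (0 : EuclideanSpace ℝ (Fin (n + 1))) 1)).toReal
        + 1 / n) * D ^ (n + 1) * b) * relPerimeter C E := by
    intro k
    refine (lintegral_lintegral_enorm_sub_le volume (by simp) hn
      ((huC k).of_le (by exact_mod_cast le_top)) hKconv hK.measurableSet hAK hBK hAm hBm hb0 hD hAb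
      hdiam).trans ?_
    gcongr
    refine lintegral_enorm_fderiv_mollify_le hK hKC hE hEfin (φ k).contDiff_normed
      (φ k).nonneg_normed (φ k).integral_normed ?_ (φ k).normed_neg
    rw [(φ k).tsupport_normed_eq]
    refine Metric.closedBall_subset_closedBall ?_
    exact div_le_self hε.le (by simp)
  calc volume A * volume B = ∫⁻ x in A, ∫⁻ y in B, 1 := by
        simp [mul_comm]
    _ = ∫⁻ x in A, ∫⁻ y in B, liminf (fun k => ‖u k x - u k y‖ₑ) atTop := by
        refine lintegral_congr_ae ?_
        filter_upwards [ae_restrict_mem₀ hAm, ae_restrict_of_ae hconv] with x hx hx'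
        refine lintegral_congr_ae ?_
        filter_upwards [ae_restrict_mem₀ hBm, ae_restrict_of_ae hconv] with y hy hy'
        rw [(hx'.sub hy').enorm.liminf_eq, hAB x hx y hy]
    _ ≤ ∫⁻ x in A, liminf (fun k => ∫⁻ y in B, ‖u k x - u k y‖ₑ) atTop := by
        refine lintegral_mono fun x => lintegral_liminf_le fun k => ?_
        have := (huC k).continuous
        fun_prop
    _ ≤ liminf (fun k => ∫⁻ x in A, ∫⁻ y in B, ‖u k x - u k y‖ₑ) atTop := by
        refine lintegral_liminf_le fun k => ?_
        have := (huC k).continuous.measurable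
        exact Measurable.lintegral_prod_right (f := fun x y => ‖u k x - u k y‖ₑ) (by fun_prop)
    _ ≤ _ := liminf_le_of_frequently_le' (Frequently.of_forall hbound)
    _ = _ := by
        rw [ENNReal.ofReal_mul (by positivity), hAa, ENNReal.ofReal_rpow_of_pos ha0]

theorem cthickening_homothety_image_subset {V : Type*} [NormedAddCommGroup V] [NormedSpace ℝ V]
    [FiniteDimensional ℝ V] {C : Set V} (hC : Convex ℝ C) (hCc : IsCompact C) {y : V} {r s : ℝ}
    (hr : 0 < r) (hs : 0 < s) (hs1 : s < 1) (hy : Metric.closedBall y r ⊆ C) :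
    Metric.cthickening (s * r / 2) (AffineMap.homothety y (1 - s) '' C) ⊆ interior C := by
  have hKc : IsCompact (AffineMap.homothety y (1 - s) '' C) :=
    hCc.image (AffineMap.homothety_continuous _ _)
  intro z hz
  rw [hKc.cthickening_eq_biUnion_closedBall (by positivity)] at hz
  simp only [Set.mem_iUnion, exists_prop] at hz
  obtain ⟨_, ⟨c, hc, rfl⟩, hz⟩ := hz
  rw [mem_interior_iff_mem_nhds, Metric.mem_nhds_iff]
  refine ⟨s * r / 2, by positivity, fun w hw => ?_⟩
  set p := AffineMap.homothety y (1 - s) c with hp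
  have hwp : ‖w - p‖ ≤ s * r := by
    rw [← dist_eq_norm]
    have h1 : dist w z < s * r / 2 := hw
    have h2 : dist z p ≤ s * r / 2 := hz
    linarith [dist_triangle w z p]
  have hq : y + s⁻¹ • (w - p) ∈ C := by
    refine hy ?_
    rw [mem_closedBall_iff_norm, add_sub_cancel_left, norm_smul, norm_inv, Real.norm_of_nonneg hs.le]
    rw [inv_mul_le_iff₀ hs]
    exact hwp
  have hw' : w = (1 - s) • c + s • (y + s⁻¹ • (w - p)) := by
    rw [smul_add, smul_smul, mul_inv_cancel₀ hs.ne', one_smul, hp, AffineMap.homothety_apply]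
    simp only [vsub_eq_sub, vadd_eq_add, smul_sub, sub_smul, one_smul]
    abel
  rw [hw']
  exact hC hc hq (by linarith) hs.le (by ring)

open Filter Topology in
theorem tendsto_measure_inter_homothety_image {V : Type*} [NormedAddCommGroup V] [NormedSpace ℝ V]
    [FiniteDimensional ℝ V] [MeasurableSpace V] [BorelSpace V] (μ : Measure V) [μ.IsAddHaarMeasure]
    {C A : Set V} (hC : Convex ℝ C) (hCc : IsCompact C) {y : V} (hy : y ∈ C) (hA : A ⊆ C) :
    Tendsto (fun s : ℝ => μ (A ∩ AffineMap.homothety y (1 - s) '' C)) (𝓝[>] 0) (𝓝 (μ A)) := by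
  have hCfin : μ C ≠ ⊤ := hCc.measure_lt_top.ne
  set d := Module.finrank ℝ V
  have hδ : Tendsto (fun s : ℝ => μ A - (μ C - ENNReal.ofReal |(1 - s) ^ d| * μ C)) (𝓝[>] 0)
      (𝓝 (μ A)) := by
    have hc : Continuous fun s : ℝ => |(1 - s) ^ d| := by fun_prop
    have h1 : Tendsto (fun s : ℝ => ENNReal.ofReal |(1 - s) ^ d|) (𝓝[>] 0) (𝓝 1) := by
      have h := ((ENNReal.continuous_ofReal.comp hc).tendsto 0).mono_left
        (nhdsWithin_le_nhds (s := Set.Ioi 0))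
      have h0 : (ENNReal.ofReal ∘ fun s : ℝ => |(1 - s) ^ d|) 0 = 1 := by simp
      rwa [h0] at h
    have h2 := ENNReal.Tendsto.sub (tendsto_const_nhds (x := μ A))
      (ENNReal.Tendsto.sub (tendsto_const_nhds (x := μ C))
        (ENNReal.Tendsto.mul_const (b := μ C) h1 (Or.inr hCfin)) (Or.inl hCfin))
      (Or.inr (by simp))
    simpa using h2
  refine tendsto_of_tendsto_of_tendsto_of_le_of_le' hδ tendsto_const_nhds ?_
    (Eventually.of_forall fun s => measure_mono Set.inter_subset_left)
  have hlt : ∀ᶠ s : ℝ in 𝓝[>] 0, s < 1 := nhdsWithin_le_nhds (gt_mem_nhds one_pos)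
  filter_upwards [self_mem_nhdsWithin, hlt] with s hs hs1
  have hs0 : 0 < s := hs
  have hKC : AffineMap.homothety y (1 - s) '' C ⊆ C := by
    rintro _ ⟨c, hc, rfl⟩
    rw [AffineMap.homothety_eq_lineMap]
    exact hC.lineMap_mem hy hc ⟨by linarith, by linarith⟩
  have hKm : MeasurableSet (AffineMap.homothety y (1 - s) '' C) :=
    (hCc.image (AffineMap.homothety_continuous _ _)).measurableSet
  rw [← Measure.addHaar_image_homothety μ y (1 - s) C,
    ← measure_sdiff hKC hKm.nullMeasurableSet (((measure_mono hKC).trans_lt hCc.measure_lt_top).ne),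
    tsub_le_iff_right]
  refine (measure_mono fun z hz => ?_).trans (measure_union_le _ _)
  by_cases h : z ∈ AffineMap.homothety y (1 - s) '' C
  · exact Or.inl ⟨hz, h⟩
  · exact Or.inr ⟨hA hz, h⟩

open Filter Topology in
theorem volume_mul_volume_le_relPerimeter (hn : 1 ≤ n)
    {C E A B : Set (EuclideanSpace ℝ (Fin (n + 1)))} {x y : EuclideanSpace ℝ (Fin (n + 1))}
    {r R : ℝ} (hC : Convex ℝ C) (hCc : IsCompact C) (hr : 0 < r) (hR : 0 < R)
    (hy : Metric.closedBall y r ⊆ C) (hx : C ⊆ Metric.closedBall x R)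
    (hE : NullMeasurableSet E volume) (hEC : E ⊆ C)
    (hA : A ⊆ C) (hB : B ⊆ C) (hAm : NullMeasurableSet A volume)
    (hBm : NullMeasurableSet B volume)
    (hAB : ∀ x ∈ A, ∀ y ∈ B, ‖E.indicator (fun _ => (1 : ℝ)) x - E.indicator (fun _ => (1 : ℝ)) y‖ₑ = 1) :
    volume A * volume B ≤
      ENNReal.ofReal (((volume (Metric.ball (0 : EuclideanSpace ℝ (Fin (n + 1))) 1)).toReal
        + 1 / n) * (2 * R) ^ (n + 1)) * volume A ^ (1 / ((n : ℝ) + 1)) * relPerimeter C E := by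
  have hyC : y ∈ C := hy (Metric.mem_closedBall_self hr.le)
  have hfin : ∀ {S : Set (EuclideanSpace ℝ (Fin (n + 1)))}, S ⊆ C → volume S ≠ ⊤ := fun h =>
    ((measure_mono h).trans_lt hCc.measure_lt_top).ne
  have hlim := ENNReal.Tendsto.mul (tendsto_measure_inter_homothety_image volume hC hCc hyC hA)
    (Or.inr (hfin hB)) (tendsto_measure_inter_homothety_image volume hC hCc hyC hB)
    (Or.inr (hfin hA))
  have hlt : ∀ᶠ s : ℝ in 𝓝[>] 0, s < 1 := nhdsWithin_le_nhds (gt_mem_nhds one_pos)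
  refine le_of_tendsto hlim ?_
  filter_upwards [self_mem_nhdsWithin, hlt] with s hs hs1
  have hs0 : 0 < s := hs
  set K := AffineMap.homothety y (1 - s) '' C with hKdef
  have hK : IsCompact K := hCc.image (AffineMap.homothety_continuous _ _)
  have hKC := cthickening_homothety_image_subset hC hCc hr hs0 hs1 hy
  have hKsub : K ⊆ C := (Metric.self_subset_cthickening K).trans (hKC.trans interior_subset)
  have hKm := hK.measurableSet.nullMeasurableSet (μ := volume)
  refine (volume_mul_volume_le_of_cthickening_subset hn (ε := s * r / 2) (D := 2 * R)
    (by positivity) (by positivity) hK (hC.affine_image _) hKC ?_ hE (hfin hEC)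
    Set.inter_subset_right Set.inter_subset_right (hAm.inter hKm) (hBm.inter hKm)
    fun x hx y hy => hAB x hx.1 y hy.1).trans ?_
  · intro p hp q hq
    have h1 := hx (hKsub hp)
    have h2 := hx (hKsub hq)
    rw [← dist_eq_norm]
    rw [Metric.mem_closedBall] at h1 h2
    linarith [dist_triangle_right q p x]
  · gcongr
    exact Set.inter_subset_left

theorem theorem4p11 (n : ℕ) (hn : 1 ≤ n) (ρ : ℝ) :
    ∃ M : ℝ, 0 < M ∧
      ∀ (C : Set (EuclideanSpace ℝ (Fin (n + 1)))) (x y : EuclideanSpace ℝ (Fin (n + 1)))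
        (r R : ℝ), IsConvexBody C → x ∈ C → y ∈ C → 0 < r → r < R → R / r = ρ →
        Metric.closedBall y r ⊆ C → C ⊆ Metric.closedBall x R →
        ∀ v : ℝ, 0 ≤ v → v ≤ (volume C).toReal →
          ENNReal.ofReal (M * (min v ((volume C).toReal - v)) ^ ((n : ℝ) / ((n : ℝ) + 1))) ≤
            isoperimetricProfile C v := by
  rcases le_or_gt ρ 0 with hρ | hρ
  · refine ⟨1, one_pos, fun C x y r R _ _ _ hr hrR hRr => ?_⟩
    have : 0 < R / r := div_pos (hr.trans hrR) hr
    linarith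
  set κ := (volume (Metric.ball (0 : EuclideanSpace ℝ (Fin (n + 1))) 1)).toReal with hκ
  have hκ0 : 0 < κ := ENNReal.toReal_pos (Metric.measure_ball_pos _ _ one_pos).ne'
    measure_ball_lt_top.ne
  have hn0 : (0 : ℝ) < n := by exact_mod_cast hn
  refine ⟨κ / (2 * ((κ + 1 / n) * (2 * ρ) ^ (n + 1))), by positivity, ?_⟩
  intro C x y r R hC _ _ hr hrR hRr hyC hCx v hv0 hvC
  have hR : R = ρ * r := by rw [← hRr]; field_simp
  have hCfin : volume C ≠ ⊤ := hC.isCompact.measure_lt_top.ne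
  set W := (volume C).toReal with hW
  have hWr : κ * r ^ (n + 1) ≤ W := by
    have h1 := measure_mono (μ := volume) hyC
    rw [Measure.addHaar_closedBall volume _ hr.le] at h1
    have h2 := ENNReal.toReal_mono hCfin h1
    rw [ENNReal.toReal_mul, ENNReal.toReal_ofReal (by positivity)] at h2
    simpa [mul_comm] using h2
  refine le_iInf fun E => le_iInf fun hEC => le_iInf fun hE => le_iInf fun hEv => ?_
  set P := relPerimeter C E
  have hCm := hC.isCompact.measurableSet
  have hdiff : volume (C \ E) = ENNReal.ofReal (W - v) := by
    rw [measure_sdiff hEC hE (by simp [hEv]), hEv, ENNReal.ofReal_sub _ hv0, hW,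
      ENNReal.ofReal_toReal hCfin]
  have hdm : NullMeasurableSet (C \ E) volume := hCm.nullMeasurableSet.diff hE
  have hind : ∀ p ∈ E, ∀ q ∈ C \ E,
      ‖E.indicator (fun _ => (1 : ℝ)) p - E.indicator (fun _ => (1 : ℝ)) q‖ₑ = 1 := fun p hp q hq => by
    simp [hp, hq.2]
  have hR0 := hr.trans hrR
  have hE1 := volume_mul_volume_le_relPerimeter hn hC.convex hC.isCompact hr hR0 hyC hCx hE hEC
    hEC Set.sdiff_subset hE hdm hind
  have hE2 := volume_mul_volume_le_relPerimeter hn hC.convex hC.isCompact hr hR0 hyC hCx hE hEC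
    Set.sdiff_subset hEC hdm hE fun p hp q hq => by rw [← hind q hq p hp, ← enorm_neg, neg_sub]
  rw [hEv, hdiff] at hE1 hE2
  set m := min v (W - v) with hm
  have hm0 : 0 ≤ m := le_min hv0 (by linarith)
  have hkey : ENNReal.ofReal m * ENNReal.ofReal (W / 2) ≤
      ENNReal.ofReal ((κ + 1 / n) * (2 * R) ^ (n + 1)) *
        ENNReal.ofReal m ^ (1 / ((n : ℝ) + 1)) * P := by
    rcases le_total v (W - v) with h | h
    · rw [hm, min_eq_left h]
      refine le_trans ?_ hE1
      gcongr
      linarith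
    · rw [hm, min_eq_right h]
      refine le_trans ?_ hE2
      gcongr
      linarith
  rcases hm0.eq_or_lt with h0 | hmpos
  · rw [← h0, Real.zero_rpow (by positivity)]
    simp
  rcases eq_or_ne P ⊤ with hP | hP
  · simp [hP]
  obtain ⟨p, hp0, hpP⟩ : ∃ p : ℝ, 0 ≤ p ∧ P = ENNReal.ofReal p :=
    ⟨P.toReal, ENNReal.toReal_nonneg, (ENNReal.ofReal_toReal hP).symm⟩
  rw [hpP]
  rw [hpP, ENNReal.ofReal_rpow_of_pos hmpos, ← ENNReal.ofReal_mul hm0,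
    ← ENNReal.ofReal_mul (by positivity), ← ENNReal.ofReal_mul (by positivity),
    ENNReal.ofReal_le_ofReal_iff (by positivity)] at hkey
  refine ENNReal.ofReal_le_ofReal ?_
  set b := m ^ (1 / ((n : ℝ) + 1)) with hb
  have hb0 : 0 < b := Real.rpow_pos_of_pos hmpos _
  set q := m ^ ((n : ℝ) / ((n : ℝ) + 1)) with hq
  have hq0 : 0 < q := Real.rpow_pos_of_pos hmpos _
  have hmb : m = q * b := by
    rw [hq, hb, ← Real.rpow_add hmpos, ← add_div, div_self (by positivity), Real.rpow_one]
  have h1 : q * (W / 2) ≤ (κ + 1 / n) * (2 * R) ^ (n + 1) * p := by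
    refine le_of_mul_le_mul_right ?_ hb0
    calc q * (W / 2) * b = m * (W / 2) := by rw [hmb]; ring
      _ ≤ _ := hkey
      _ = _ := by ring
  have h2 : q * κ * r ^ (n + 1) ≤ 2 * ((κ + 1 / n) * (2 * ρ) ^ (n + 1)) * p * r ^ (n + 1) := by
    calc q * κ * r ^ (n + 1) = q * (κ * r ^ (n + 1)) := by ring
      _ ≤ q * W := by gcongr
      _ = 2 * (q * (W / 2)) := by ring
      _ ≤ 2 * ((κ + 1 / n) * (2 * R) ^ (n + 1) * p) := by gcongr
      _ = _ := by rw [hR, ← mul_assoc 2 ρ r, mul_pow (2 * ρ) r]; ring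
  have h3 := le_of_mul_le_mul_right h2 (by positivity)
  rw [div_mul_eq_mul_div, div_le_iff₀ (by positivity)]
  linarith
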